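/- For an even integer $n\ge 2$ and an integer $d\ge 1$, let $T_{n,d}$ be the graph with vertex set $\{0,1,\dots,n-1\}$ in which $i$ and $j$ are adjacent if and only if $\min\{|i-j|,\,n-|i-j|\}\in\{1,3,\dots,2d+1\}$. Let $\mathrm{Hom}(T_{n,d},0)$ be the (finite, non-empty) set of functions $f\colon\{0,\dots,n-1\}\to\mathbb{Z}$ with $f(0)=0$ and $|f(i)-f(j)|=1$ whenever $i$ and $j$ are adjacent in $T_{n,d}$, and let $f_{n,d}$ be a uniformly chosen element of it. Write $\mathrm{Rng}(f)$ for the set of values of $f$. For $i\in\{0,1\}$ let $V_i=\{2k+i : 0\le k<n/2\}$ (the even vertices for $i=0$, the odd vertices for $i=1$), and let $\Omega_i$ be the event that $f_{n,d}$ is constant on $V_i$. Let $d(n)$ be positive integers, defined for even $n\ge 2$, such that $d(n)-\log_2 n\to\infty$ as $n\to\infty$ through even numbers. Then, with $d=d(n)$, $$\Pr(\Omega_0\cup\Omega_1)=\Pr\big(|\mathrm{Rng}(f_{n,d(n)})|\le 3\big)\longrightarrow 1 \qquad\text{and}\qquad \Pr(\Omega_0)=\Pr(\Omega_1)\longrightarrow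 \tfrac12$$ as $n\to\infty$ through even numbers, where the two equalities hold for every even $n\ge 2$. -/

import Mathlib

open Filter Topology MeasureTheory ProbabilityTheory

noncomputable section

/-- `Hom(G, v₀)`: the `ℤ`-valued functions on the vertices of `G` which vanish at `v₀` and map
adjacent vertices to adjacent integers. -/
def zHom {V : Type*} (G : SimpleGraph V) (v₀ : V) : Set (V → ℤ) :=
  {f | f v₀ = 0 ∧ ∀ x y, G.Adj x y → |f x - f y| = 1}

/-- The cyclic distance `min {|x - y|, n - |x - y|}` on `{0, …, n - 1}`. -/
def cyclicDist {n : ℕ} (x y : Fin n) : ℕ :=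
  min (Nat.dist x y) (n - Nat.dist x y)

/-- The torus graph `T_{n,d}`: its vertices are `0, …, n - 1`, and two vertices are adjacent when
their cyclic distance is one of `1, 3, …, 2d + 1`. -/
def torusGraph (n d : ℕ) : SimpleGraph (Fin n) where
  Adj x y := ∃ k ≤ d, cyclicDist x y = 2 * k + 1
  symm := ⟨by
    rintro x y ⟨k, hk, h⟩
    exact ⟨k, hk, by rw [← h, cyclicDist, cyclicDist, Nat.dist_comm]⟩⟩
  loopless := ⟨by
    rintro x ⟨k, -, h⟩
    simp [cyclicDist, Nat.dist_self] at h⟩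

/-- `Hom(T_{n,d}, 0)`. It is empty for `n = 0`, where there is no vertex `0`. -/
def torusHom (n d : ℕ) : Set (Fin n → ℤ) :=
  {f | ∃ h : 0 < n, f ∈ zHom (torusGraph n d) ⟨0, h⟩}

/-- The law of a uniformly chosen element of `Hom(T_{n,d}, 0)`. -/
def torusLaw (n d : ℕ) : Measure (Fin n → ℤ) :=
  uniformOn (torusHom n d)

/-- `V_i = {2k + i | 0 ≤ k < n/2}`: the even vertices for `i = 0`, the odd ones for `i = 1`. -/
def parityVertices (n i : ℕ) : Set (Fin n) :=
  {v | ∃ k < n / 2, (v : ℕ) = 2 * k + i}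

/-- `Ω_i`: the homomorphisms in `Hom(T_{n,d}, 0)` which are constant on `V_i`. -/
def constOn (n d i : ℕ) : Set (Fin n → ℤ) :=
  {f | f ∈ torusHom n d ∧ ∃ c : ℤ, ∀ v ∈ parityVertices n i, f v = c}

/-- The event that the range of the homomorphism has at most three elements. -/
def rangeLeThree (n d : ℕ) : Set (Fin n → ℤ) :=
  {f | f ∈ torusHom n d ∧ (Set.range f).ncard ≤ 3}

/-- The filter `n → ∞` through even numbers. -/
def evenAtTop : Filter ℕ := atTop ⊓ 𝓟 {n | Even n}

end

/-! The proof compares two counts. Fixing one parity class and choosing signs on the other gives at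
least `2 ^ (n / 2)` elements of `Ω_0`. Conversely, dropping the wrap-around edges embeds the torus
homomorphisms in `pathHom d n`, whose size is at most `2 * 2 ^ (n / 2) * (1 + 2⁻ᵈ) ^ (n / 2)`
(`ncard_pathHom_even_le`). Hence `2 Pr(Ω_0) ≥ exp (-n 2⁻ᵈ)`, which tends to `1` because `d - log₂ n
→ ∞`.

For the path count, write `N m` for the size of `pathHom d m`. A vertex has two possible values only
if its recent neighbours all agree. If two consecutive vertices are both free, then both parity
classes are locally constant, so the function is already periodic about `2d` steps earlier.
Inclusion–exclusion gives `N (m + 2) ≤ 2 * N m + N (m + 1 - 2d)`.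

Rotation by one step gives `Pr(Ω_0) = Pr(Ω_1)`, and `Ω_0 ∩ Ω_1` has at most two elements. So `2
Pr(Ω_0)` exceeds `Pr(Ω_0 ∪ Ω_1)` by an exponentially small amount at most, which yields both limits.
-/

/-! ### Half-line homomorphisms and folding -/

/-- The homomorphisms on the half-line `ℕ`, where `i` is joined to `i + 1, i + 3, …, i + 2d + 1`,
which vanish at `0` and have period two from `m - 2` on. -/
def pathHom (d m : ℕ) : Set (ℕ → ℤ) :=
  {f | f 0 = 0 ∧ (∀ i k, k ≤ d → |f i - f (i + (2 * k + 1))| = 1) ∧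
    ∀ i, m ≤ i + 2 → f (i + 2) = f i}

/-- The elements of `pathHom d m` for which the vertex `m` could take two values. -/
def freePathHom (d m : ℕ) : Set (ℕ → ℤ) :=
  {f | f ∈ pathHom d m ∧ ∀ i j, 1 ≤ j → j ≤ d → i + 2 * j + 1 = m → f (i + 2) = f i}

/-- The retraction of `ℕ` onto `{0, …, m - 1}` which has period two from `m - 2` on. -/
def foldTail (m i : ℕ) : ℕ := if i < m then i else m - 2 + (i - m) % 2

lemma foldTail_of_lt {m i : ℕ} (h : i < m) : foldTail m i = i := if_pos h

lemma foldTail_add_two {m i : ℕ} (hm : 2 ≤ m) (h : m ≤ i + 2) :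
    foldTail m (i + 2) = foldTail m i := by
  unfold foldTail
  split_ifs <;> omega

lemma foldTail_lt {m : ℕ} (hm : 2 ≤ m) (i : ℕ) : foldTail m i < m := by
  unfold foldTail
  split_ifs <;> omega

/-- Folding preserves parity and never lengthens an edge, so it is a graph homomorphism. -/
lemma foldTail_adj {m d : ℕ} (hm : 2 ≤ m) (i k : ℕ) (hk : k ≤ d) :
    ∃ l ≤ d, foldTail m (i + (2 * k + 1)) = foldTail m i + (2 * l + 1) ∨
      foldTail m i = foldTail m (i + (2 * k + 1)) + (2 * l + 1) := by
  by_cases h1 : i + (2 * k + 1) < m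
  · exact ⟨k, hk, Or.inl (by rw [foldTail_of_lt h1, foldTail_of_lt (by omega)])⟩
  by_cases h2 : i < m
  · by_cases h3 : foldTail m (i + (2 * k + 1)) < i
    · refine ⟨0, by omega, Or.inr ?_⟩
      unfold foldTail at *
      grind
    · refine ⟨(foldTail m (i + (2 * k + 1)) - i) / 2, ?_, Or.inl ?_⟩ <;>
      · unfold foldTail at *
        grind
  · refine ⟨0, by omega, ?_⟩
    unfold foldTail at *
    grind

lemma pathHom_mono {d m m' : ℕ} (h : m ≤ m') : pathHom d m ⊆ pathHom d m' :=
  fun _ hf => ⟨hf.1, hf.2.1, fun i hi => hf.2.2 i (h.trans hi)⟩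

lemma comp_foldTail_mem {d m m' : ℕ} (hm : 2 ≤ m) {f : ℕ → ℤ} (hf : f ∈ pathHom d m') :
    f ∘ foldTail m ∈ pathHom d m := by
  refine ⟨?_, fun i k hk => ?_, fun i hi => ?_⟩
  · simp [foldTail_of_lt (show 0 < m by omega), hf.1]
  · obtain ⟨l, hl, h | h⟩ := foldTail_adj hm i k hk
    · simp only [Function.comp, h]
      exact hf.2.1 _ l hl
    · simp only [Function.comp, h]
      rw [abs_sub_comm]
      exact hf.2.1 _ l hl
  · simp only [Function.comp, foldTail_add_two hm hi]

/-- Truncation is injective on the homomorphisms that branch at the vertex `m`. -/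
lemma foldTail_injOn {d m : ℕ} (hm : 2 ≤ m) :
    Set.InjOn (fun f : ℕ → ℤ => f ∘ foldTail m) (pathHom d (m + 1) \ pathHom d m) := by
  obtain ⟨m, rfl⟩ : ∃ k, m = k + 2 := ⟨m - 2, by omega⟩
  have key : ∀ f ∈ pathHom d (m + 2 + 1) \ pathHom d (m + 2), f (m + 2) ≠ f m := by
    rintro f ⟨hf, hf'⟩ h
    refine hf' ⟨hf.1, hf.2.1, fun i hi => ?_⟩
    obtain rfl | hi := (show m ≤ i by omega).eq_or_lt
    · exact h
    · exact hf.2.2 i (by omega)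
  rintro f hf g hg hfg
  have hlt : ∀ i < m + 2, f i = g i := fun i hi => by
    simpa [foldTail_of_lt hi] using congrFun hfg i
  -- A value one away from `f (m + 1)` and different from `f m` must be `2 * f (m + 1) - f m`.
  have h2 : f (m + 2) = g (m + 2) := by
    have a1 := hf.1.2.1 m 0 (by omega)
    have a2 := hf.1.2.1 (m + 1) 0 (by omega)
    have b1 := hg.1.2.1 m 0 (by omega)
    have b2 := hg.1.2.1 (m + 1) 0 (by omega)
    have c1 := key f hf
    have c2 := key g hg
    have e1 := hlt m (by omega)
    have e2 := hlt (m + 1) (by omega)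
    simp only [mul_zero, zero_add, add_assoc, Nat.reduceAdd] at a1 a2 b1 b2
    grind
  have all : ∀ i, f i = g i := by
    intro i
    induction i using Nat.strong_induction_on with
    | _ i ih =>
      by_cases h : i < m + 2
      · exact hlt i h
      by_cases h' : i = m + 2
      · rw [h', h2]
      obtain ⟨j, rfl⟩ : ∃ j, i = j + 2 := ⟨i - 2, by omega⟩
      rw [hf.1.2.2 j (by omega), hg.1.2.2 j (by omega), ih j (by omega)]
  exact funext all

/-- If `f m ≠ f (m - 2)`, every common neighbour of `m` and `m - 2` takes the midpoint value, so
these neighbours all agree. -/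
lemma comp_foldTail_mem_free {d m : ℕ} (hm : 2 ≤ m) :
    Set.MapsTo (fun f : ℕ → ℤ => f ∘ foldTail m) (pathHom d (m + 1) \ pathHom d m)
      (freePathHom d m) := by
  obtain ⟨m, rfl⟩ : ∃ k, m = k + 2 := ⟨m - 2, by omega⟩
  rintro f ⟨hf, hf'⟩
  have hne : f (m + 2) ≠ f m := by
    intro h
    refine hf' ⟨hf.1, hf.2.1, fun i hi => ?_⟩
    obtain rfl | hi := (show m ≤ i by omega).eq_or_lt
    · exact h
    · exact hf.2.2 i (by omega)
  refine ⟨comp_foldTail_mem hm hf, fun i j hj hjd hij => ?_⟩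
  have hi : i + 2 < m + 2 := by omega
  simp only [Function.comp, foldTail_of_lt hi, foldTail_of_lt (show i < m + 2 by omega)]
  have a1 := hf.2.1 i j hjd
  have a2 := hf.2.1 i (j - 1) (by omega)
  have a3 := hf.2.1 (i + 2) (j - 1) (by omega)
  rw [show i + (2 * j + 1) = m + 2 by omega] at a1
  rw [show i + (2 * (j - 1) + 1) = m by omega] at a2
  rw [show i + 2 + (2 * (j - 1) + 1) = m + 2 by omega] at a3
  -- For `j = 1` the vertex `i + 2` lies after the lower of the two compared vertices, so that edge
  -- is read backwards.
  have a4 : |f (i + 2) - f m| = 1 := by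
    obtain rfl | h1 := hj.eq_or_lt
    · have := hf.2.1 m 0 (by omega)
      rw [abs_sub_comm, show i + 2 = m + (2 * 0 + 1) by omega]
      exact this
    · have := hf.2.1 (i + 2) (j - 2) (by omega)
      rwa [show i + 2 + (2 * (j - 2) + 1) = m by omega] at this
  grind

/-! ### Counting half-line homomorphisms -/

lemma pathHom_zero_subset (d : ℕ) :
    pathHom d 0 ⊆ {fun i => if i % 2 = 0 then 0 else 1, fun i => if i % 2 = 0 then 0 else -1} := by
  intro f hf
  have h1 : ∀ i, f i = if i % 2 = 0 then 0 else f 1 := by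
    intro i
    induction i using Nat.twoStepInduction with
    | zero => simp [hf.1]
    | one => simp
    | more i h _ => rw [hf.2.2 i (by omega), h]; simp
  have h2 := hf.2.1 0 0 (by omega)
  simp only [hf.1, zero_sub, mul_zero, zero_add, abs_neg] at h2
  rcases eq_or_eq_neg_of_abs_eq h2 with h | h
  · left; funext i; rw [h1, h]
  · right; funext i; rw [h1, h]

lemma pathHom_two (d : ℕ) : pathHom d 2 = pathHom d 0 :=
  (pathHom_mono (by omega)).antisymm' fun _ hf => ⟨hf.1, hf.2.1, fun i _ => hf.2.2 i (by omega)⟩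

lemma freePathHom_subset (d m : ℕ) : freePathHom d m ⊆ pathHom d m := fun _ h => h.1

lemma pathHom_finite (d m : ℕ) : (pathHom d m).Finite := by
  have h0 : (pathHom d 0).Finite := Set.Finite.subset (by simp) (pathHom_zero_subset d)
  induction m with
  | zero => exact h0
  | succ m ih =>
    by_cases hm : 2 ≤ m
    · have : (pathHom d (m + 1) \ pathHom d m).Finite :=
        Set.Finite.of_injOn (comp_foldTail_mem_free hm) (foldTail_injOn hm)
          (ih.subset (freePathHom_subset d m))
      exact (this.union ih).subset fun f hf => by
        by_cases h : f ∈ pathHom d m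
        · exact Or.inr h
        · exact Or.inl ⟨hf, h⟩
    · rw [← pathHom_two] at h0
      exact h0.subset (pathHom_mono (by omega))

lemma ncard_pathHom_succ_le {d m : ℕ} (hm : 2 ≤ m) :
    (pathHom d (m + 1)).ncard ≤ (pathHom d m).ncard + (freePathHom d m).ncard := by
  have h := Set.ncard_le_ncard_of_injOn _ (comp_foldTail_mem_free (d := d) hm) (foldTail_injOn hm)
    ((pathHom_finite d m).subset (freePathHom_subset d m))
  have h' := Set.ncard_sdiff_add_ncard_of_subset
    (pathHom_mono (d := d) (show m ≤ m + 1 by omega)) (pathHom_finite d (m + 1))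
  omega

lemma freePathHom_succ_subset {d m : ℕ} (hd : 1 ≤ d) :
    freePathHom d (m + 1) ⊆ pathHom d m := by
  rintro f ⟨hf, h⟩
  refine ⟨hf.1, hf.2.1, fun i hi => ?_⟩
  obtain hi | hi := hi.eq_or_lt
  · exact h i 1 le_rfl hd (by omega)
  · exact hf.2.2 i hi

/-- Freeness at `m` and at `m + 1` controls the two parity classes on the last `2d` or so vertices;
together they extend the period-two tail backwards. -/
lemma freePathHom_inter_subset (d m : ℕ) :
    freePathHom d m ∩ freePathHom d (m + 1) ⊆ pathHom d (m + 1 - 2 * d) := by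
  rintro f ⟨⟨hf, h⟩, ⟨hf', h'⟩⟩
  refine ⟨hf.1, hf.2.1, fun i hi => ?_⟩
  by_cases h1 : m ≤ i + 2
  · exact hf.2.2 i h1
  · obtain ⟨j, hj | hj⟩ := Nat.even_or_odd' (m - i)
    · exact h' i j (by omega) (by omega) (by omega)
    · exact h i j (by omega) (by omega) (by omega)

lemma ncard_pathHom_add_two_le {d m : ℕ} (hd : 1 ≤ d) (hm : 2 ≤ m) :
    (pathHom d (m + 2)).ncard ≤ 2 * (pathHom d m).ncard + (pathHom d (m + 1 - 2 * d)).ncard := by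
  have h1 := ncard_pathHom_succ_le (d := d) hm
  have h2 : (pathHom d (m + 2)).ncard ≤ _ :=
    ncard_pathHom_succ_le (d := d) (m := m + 1) (by omega)
  have fin := pathHom_finite d m
  have s1 := freePathHom_subset d m
  have s2 := freePathHom_succ_subset (m := m) hd
  have h3 := Set.ncard_union_add_ncard_inter (freePathHom d m) (freePathHom d (m + 1))
    (fin.subset s1) (fin.subset s2)
  have h4 := Set.ncard_le_ncard (Set.union_subset s1 s2) fin
  have h5 := Set.ncard_le_ncard (freePathHom_inter_subset d m) (pathHom_finite d _)
  omega

lemma ncard_pathHom_zero_le (d : ℕ) : (pathHom d 0).ncard ≤ 2 :=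
  (Set.ncard_le_ncard (pathHom_zero_subset d) (by simp)).trans <|
    (Set.ncard_insert_le _ _).trans (by simp)

lemma ncard_pathHom_even_step {d : ℕ} (hd : 1 ≤ d) (k : ℕ) :
    (pathHom d (2 * (k + 1))).ncard ≤
      2 * (pathHom d (2 * k)).ncard + (pathHom d (2 * (k + 1 - d))).ncard := by
  rcases Nat.eq_zero_or_pos k with rfl | hk
  · simp only [mul_zero, zero_add, mul_one, pathHom_two]
    omega
  · have h := ncard_pathHom_add_two_le (m := 2 * k) hd (by omega)
    have h' := Set.ncard_le_ncard
      (pathHom_mono (d := d) (show 2 * k + 1 - 2 * d ≤ 2 * (k + 1 - d) by omega))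
      (pathHom_finite d _)
    rw [show 2 * (k + 1) = 2 * k + 2 by ring]
    omega

/-- Here the second term of the recursion is `N 0 ≤ 2`, so `N + 2` at most doubles. -/
lemma ncard_pathHom_even_le_of_le {d k : ℕ} (hk : 1 ≤ k) (hkd : k ≤ d) :
    (pathHom d (2 * k)).ncard + 2 ≤ 2 * 2 ^ k := by
  have h0 := ncard_pathHom_zero_le d
  induction k, hk using Nat.le_induction with
  | base =>
    rw [mul_one, pathHom_two]
    omega
  | succ k hk ih =>
    have h := ncard_pathHom_even_step (d := d) (by omega) k
    rw [Nat.sub_eq_zero_of_le hkd, mul_zero] at h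
    have := ih (by omega)
    rw [pow_succ]
    omega

lemma ncard_pathHom_even_le {d : ℕ} (hd : 1 ≤ d) (k : ℕ) :
    ((pathHom d (2 * k)).ncard : ℝ) ≤ 2 * 2 ^ k * (1 + (2 ^ d)⁻¹) ^ k := by
  induction k using Nat.strong_induction_on with
  | _ k ih =>
    rcases k with _ | k
    · simpa using ncard_pathHom_zero_le d
    -- Below `d` the subtraction `k + 1 - d` truncates, so the power of two cannot be split and the
    -- short-range bound is used instead.
    rcases le_or_gt d (k + 1) with hdk | hdk
    · have h : ((pathHom d (2 * (k + 1))).ncard : ℝ) ≤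
          2 * (pathHom d (2 * k)).ncard + (pathHom d (2 * (k + 1 - d))).ncard := by
        exact_mod_cast ncard_pathHom_even_step hd k
      have h1 := ih k (by omega)
      have h2 : ((pathHom d (2 * (k + 1 - d))).ncard : ℝ) ≤
          2 * (2 ^ (k + 1) * (2 ^ d)⁻¹) * (1 + (2 ^ d)⁻¹) ^ k := by
        refine (ih (k + 1 - d) (by omega)).trans ?_
        rw [pow_sub₀ (2 : ℝ) two_ne_zero hdk]
        gcongr
        · simp
        · omega
      calc _ ≤ _ := h
        _ ≤ 2 * (2 * 2 ^ k * (1 + (2 ^ d)⁻¹) ^ k) +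
            2 * (2 ^ (k + 1) * (2 ^ d)⁻¹) * (1 + (2 ^ d)⁻¹) ^ k := by gcongr
        _ = _ := by ring
    · have h : ((pathHom d (2 * (k + 1))).ncard : ℝ) ≤ 2 * 2 ^ (k + 1) := by
        exact_mod_cast (Nat.le_add_right _ 2).trans
          (ncard_pathHom_even_le_of_le (by omega : 1 ≤ k + 1) hdk.le)
      refine h.trans (le_mul_of_one_le_right (by positivity) (one_le_pow₀ ?_))
      simp

/-! ### From the torus to the half-line -/

lemma mem_torusHom_iff {n d : ℕ} (hn : 0 < n) {f : Fin n → ℤ} :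
    f ∈ torusHom n d ↔ f ⟨0, hn⟩ = 0 ∧ ∀ x y, (torusGraph n d).Adj x y → |f x - f y| = 1 :=
  ⟨fun ⟨_, h⟩ => h, fun h => ⟨hn, h⟩⟩

lemma torusGraph_adj_of_val {n d : ℕ} (hn : Even n) {x y : Fin n} {k : ℕ} (hk : k ≤ d)
    (h : (y : ℕ) = x + (2 * k + 1)) : (torusGraph n d).Adj x y := by
  obtain ⟨m, rfl⟩ := hn
  have hx := x.isLt
  have hy := y.isLt
  -- The other way round has length `2m - (2k + 1) = 2(m - k - 1) + 1`, again odd.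
  refine ⟨min k (m - k - 1), by omega, ?_⟩
  unfold cyclicDist Nat.dist
  omega

lemma odd_sub_of_torusGraph_adj {n d : ℕ} (hn : Even n) {x y : Fin n}
    (h : (torusGraph n d).Adj x y) : (x : ℕ) % 2 ≠ (y : ℕ) % 2 := by
  obtain ⟨m, rfl⟩ := hn
  obtain ⟨k, -, h⟩ := h
  have hx := x.isLt
  have hy := y.isLt
  unfold cyclicDist Nat.dist at h
  omega

lemma ncard_torusHom_le_pathHom {n d : ℕ} (hn : 0 < n) (he : Even n) :
    (torusHom n d).Finite ∧ (torusHom n d).ncard ≤ (pathHom d n).ncard := by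
  have h2 : 2 ≤ n := by obtain ⟨m, rfl⟩ := he; omega
  let e : (Fin n → ℤ) → ℕ → ℤ := fun f i => f ⟨foldTail n i, foldTail_lt h2 i⟩
  have hmaps : Set.MapsTo e (torusHom n d) (pathHom d n) := by
    intro f hf
    rw [mem_torusHom_iff hn] at hf
    refine ⟨?_, fun i k hk => ?_, fun i hi => ?_⟩
    · simp only [e, foldTail_of_lt hn, hf.1]
    · obtain ⟨l, hl, h | h⟩ := foldTail_adj h2 i k hk
      · exact hf.2 _ _ (torusGraph_adj_of_val he hl h)
      · exact hf.2 _ _ (torusGraph_adj_of_val he hl h).symm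
    · simp only [e, foldTail_add_two h2 hi]
  have hinj : Set.InjOn e (torusHom n d) := by
    intro f _ g _ h
    ext x
    simpa [e, foldTail_of_lt x.isLt] using congrFun h x
  exact ⟨Set.Finite.of_injOn hmaps hinj (pathHom_finite d n),
    Set.ncard_le_ncard_of_injOn e hmaps hinj (pathHom_finite d n)⟩

/-! ### Parity classes and the range -/

lemma mem_parityVertices_zero {n : ℕ} (he : Even n) (v : Fin n) :
    v ∈ parityVertices n 0 ↔ (v : ℕ) % 2 = 0 := by
  obtain ⟨m, rfl⟩ := he
  have := v.isLt
  exact ⟨fun ⟨k, _, h⟩ => by omega, fun h => ⟨v / 2, by omega, by omega⟩⟩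

lemma mem_parityVertices_one {n : ℕ} (he : Even n) (v : Fin n) :
    v ∈ parityVertices n 1 ↔ (v : ℕ) % 2 = 1 := by
  obtain ⟨m, rfl⟩ := he
  have := v.isLt
  exact ⟨fun ⟨k, _, h⟩ => by omega, fun h => ⟨v / 2, by omega, by omega⟩⟩

lemma torusHom_emod_two {n d : ℕ} (hn : 0 < n) (he : Even n) {f : Fin n → ℤ}
    (hf : f ∈ torusHom n d) (v : Fin n) : f v % 2 = (v : ℕ) % 2 := by
  rw [mem_torusHom_iff hn] at hf
  obtain ⟨v, hv⟩ := v
  induction v with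
  | zero => simp [hf.1]
  | succ v ih =>
    have h := hf.2 ⟨v, by omega⟩ ⟨v + 1, hv⟩ (torusGraph_adj_of_val he (Nat.zero_le d) rfl)
    have := ih (by omega)
    push_cast at this ⊢
    grind

lemma ncard_range_le_three {n d : ℕ} (hn : 0 < n) (he : Even n) {f : Fin n → ℤ}
    (hf : f ∈ constOn n d 0 ∪ constOn n d 1) : (Set.range f).ncard ≤ 3 := by
  have key : ∀ c : ℤ, (∀ v, f v = c ∨ |f v - c| = 1) → (Set.range f).ncard ≤ 3 := by
    intro c h
    have hs : Set.range f ⊆ (({c - 1, c, c + 1} : Finset ℤ) : Set ℤ) := by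
      rintro _ ⟨v, rfl⟩
      have := h v
      simp only [Finset.coe_insert, Finset.coe_singleton, Set.mem_insert_iff,
        Set.mem_singleton_iff]
      grind
    refine (Set.ncard_le_ncard hs (Finset.finite_toSet _)).trans ?_
    rw [Set.ncard_coe_finset]
    exact Finset.card_le_three
  have he' := he
  obtain ⟨m, rfl⟩ := he'
  rcases hf with ⟨hf, c, hc⟩ | ⟨hf, c, hc⟩ <;> rw [mem_torusHom_iff hn] at hf <;>
    refine key c fun v => ?_
  · rcases Nat.mod_two_eq_zero_or_one v with h | h
    · exact Or.inl (hc v ((mem_parityVertices_zero he v).2 h))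
    · right
      have hlt := v.isLt
      rw [← hc ⟨v - 1, by omega⟩ ((mem_parityVertices_zero he _).2 (by simp only; omega))]
      exact hf.2 _ _ (torusGraph_adj_of_val he (Nat.zero_le d) (by simp only; omega)).symm
  · rcases Nat.mod_two_eq_zero_or_one v with h | h
    · right
      have hlt := v.isLt
      rw [← hc ⟨v + 1, by omega⟩ ((mem_parityVertices_one he _).2 (by simp only; omega))]
      exact hf.2 _ _ (torusGraph_adj_of_val he (Nat.zero_le d) rfl)
    · exact Or.inl (hc v ((mem_parityVertices_one he v).2 h))

lemma mem_constOn_of_forall_eq {n d i : ℕ} {f : Fin n → ℤ} (hf : f ∈ torusHom n d)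
    (h : ∀ v ∈ parityVertices n i, ∀ w ∈ parityVertices n i, f v = f w) : f ∈ constOn n d i := by
  refine ⟨hf, ?_⟩
  rcases (parityVertices n i).eq_empty_or_nonempty with h0 | ⟨w, hw⟩
  · exact ⟨0, by simp [h0]⟩
  · exact ⟨f w, fun v hv => h v hv w hw⟩

/-- Values have the parity of their vertex, so nonconstancy on both classes produces two even and
two odd values, four in all. -/
lemma constOn_union_eq_rangeLeThree {n d : ℕ} (hn : 0 < n) (he : Even n) :
    constOn n d 0 ∪ constOn n d 1 = rangeLeThree n d := by
  ext f
  refine ⟨fun hf => ⟨hf.elim (fun h => h.1) (fun h => h.1), ncard_range_le_three hn he hf⟩, ?_⟩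
  rintro ⟨hf, hr⟩
  by_contra hcon
  rw [Set.mem_union, not_or] at hcon
  have h0 := mt (mem_constOn_of_forall_eq hf) hcon.1
  have h1 := mt (mem_constOn_of_forall_eq hf) hcon.2
  push Not at h0 h1
  obtain ⟨x, hx, y, hy, hxy⟩ := h0
  obtain ⟨z, hz, w, hw, hzw⟩ := h1
  have px := torusHom_emod_two hn he hf x
  have py := torusHom_emod_two hn he hf y
  have pz := torusHom_emod_two hn he hf z
  have pw := torusHom_emod_two hn he hf w
  rw [mem_parityVertices_zero he] at hx hy
  rw [mem_parityVertices_one he] at hz hw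
  have hs : (({f x, f y, f z, f w} : Finset ℤ) : Set ℤ) ⊆ Set.range f := by
    intro a
    simp only [Finset.coe_insert, Finset.coe_singleton, Set.mem_insert_iff,
      Set.mem_singleton_iff]
    rintro (rfl | rfl | rfl | rfl) <;> exact Set.mem_range_self _
  have hc := Set.ncard_le_ncard hs (Set.finite_range f)
  rw [Set.ncard_coe_finset, Finset.card_insert_of_notMem, Finset.card_insert_of_notMem,
    Finset.card_pair hzw] at hc
  · omega
  · simp only [Finset.mem_insert, Finset.mem_singleton]; omega
  · simp only [Finset.mem_insert, Finset.mem_singleton]; omega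

/-! ### Rotation symmetry -/

/-- Rotation of the torus by one step, renormalised to vanish at `0`. -/
def rotateHom {n : ℕ} [NeZero n] (f : Fin n → ℤ) : Fin n → ℤ := fun v => f (v + 1) - f 1

lemma val_add_one_eq {n : ℕ} [NeZero n] (h2 : 2 ≤ n) (v : Fin n) :
    ((v + 1 : Fin n) : ℕ) = if (v : ℕ) + 1 = n then 0 else (v : ℕ) + 1 := by
  have := v.isLt
  rw [Fin.val_add, Fin.val_one', Nat.mod_eq_of_lt (show 1 < n by omega)]
  split_ifs with h
  · simp [h]
  · exact Nat.mod_eq_of_lt (by omega)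

lemma cyclicDist_add_one {n : ℕ} [NeZero n] (h2 : 2 ≤ n) (x y : Fin n) :
    cyclicDist (x + 1) (y + 1) = cyclicDist x y := by
  have hx := x.isLt
  have hy := y.isLt
  unfold cyclicDist Nat.dist
  rw [val_add_one_eq h2, val_add_one_eq h2]
  split_ifs <;> omega

lemma rotateHom_mem {n d : ℕ} [NeZero n] (h2 : 2 ≤ n) {f : Fin n → ℤ} (hf : f ∈ torusHom n d) :
    rotateHom f ∈ torusHom n d := by
  have hn : 0 < n := by omega
  rw [mem_torusHom_iff hn] at hf ⊢
  refine ⟨by simp [rotateHom], ?_⟩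
  rintro x y ⟨k, hk, h⟩
  simp only [rotateHom, sub_sub_sub_cancel_right]
  exact hf.2 _ _ ⟨k, hk, by rw [cyclicDist_add_one h2, h]⟩

lemma rotateHom_injOn {n d : ℕ} [NeZero n] : Set.InjOn rotateHom (torusHom n d) := by
  intro f hf g hg h
  have hn : 0 < n := Nat.pos_of_neZero n
  rw [mem_torusHom_iff hn] at hf hg
  have h' : ∀ v, f v - f 1 = g v - g 1 := fun v => by
    simpa [rotateHom] using congrFun h (v - 1)
  -- Vanishing at `0` recovers the subtracted constant: `f 1 = g 1`.
  have h0 := h' ⟨0, hn⟩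
  rw [hf.1, hg.1] at h0
  ext v
  linarith [h' v]

lemma ncard_constOn_zero_eq_one {n d : ℕ} (hn : 0 < n) (he : Even n) :
    (constOn n d 0).ncard = (constOn n d 1).ncard := by
  have h2 : 2 ≤ n := by obtain ⟨m, rfl⟩ := he; omega
  have : NeZero n := ⟨hn.ne'⟩
  have hfin := (ncard_torusHom_le_pathHom (d := d) hn he).1
  have hs : ∀ i, constOn n d i ⊆ torusHom n d := fun i f hf => hf.1
  have he' := he
  obtain ⟨m, hm⟩ := he'
  apply le_antisymm
  · refine Set.ncard_le_ncard_of_injOn rotateHom ?_ (rotateHom_injOn.mono (hs 0))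
      (hfin.subset (hs 1))
    rintro f ⟨hf, c, hc⟩
    refine ⟨rotateHom_mem h2 hf, c - f 1, fun v hv => ?_⟩
    rw [mem_parityVertices_one he] at hv
    simp only [rotateHom]
    rw [hc]
    rw [mem_parityVertices_zero he, val_add_one_eq h2]
    split_ifs <;> omega
  · refine Set.ncard_le_ncard_of_injOn rotateHom ?_ (rotateHom_injOn.mono (hs 1))
      (hfin.subset (hs 0))
    rintro f ⟨hf, c, hc⟩
    refine ⟨rotateHom_mem h2 hf, c - f 1, fun v hv => ?_⟩
    rw [mem_parityVertices_zero he] at hv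
    simp only [rotateHom]
    rw [hc]
    rw [mem_parityVertices_one he, val_add_one_eq h2]
    split_ifs <;> omega

/-! ### Size of the constant events and of their overlap -/

lemma two_pow_le_ncard_constOn {k d : ℕ} (hk : 0 < k) :
    2 ^ k ≤ (constOn (2 * k) d 0).ncard := by
  have he : Even (2 * k) := even_two_mul k
  have hn : 0 < 2 * k := by omega
  have hfin : (constOn (2 * k) d 0).Finite :=
    (ncard_torusHom_le_pathHom (d := d) hn he).1.subset fun f hf => hf.1
  let e : (Fin k → Bool) → Fin (2 * k) → ℤ := fun s v =>
    if (v : ℕ) % 2 = 0 then 0 else if s ⟨v / 2, by have := v.isLt; omega⟩ then 1 else -1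
  have hmem : ∀ s, e s ∈ constOn (2 * k) d 0 := by
    refine fun s => ⟨(mem_torusHom_iff hn).2 ⟨by simp [e], fun x y hxy => ?_⟩, 0, fun v hv => ?_⟩
    · have := odd_sub_of_torusGraph_adj he hxy
      simp only [e]
      split_ifs <;> first | omega | simp
    · rw [mem_parityVertices_zero he] at hv
      simp [e, hv]
  have hinj : Function.Injective e := by
    intro s t h
    ext i
    have := congrFun h ⟨2 * i + 1, by have := i.isLt; omega⟩
    have h1 : (2 * (i : ℕ) + 1) % 2 ≠ 0 := by omega
    have h2 : (2 * (i : ℕ) + 1) / 2 = i := by omega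
    simp only [e, h1, h2, if_false] at this
    cases hs : s i <;> cases ht : t i <;> simp [hs, ht] at this ⊢
  have h := Set.ncard_le_ncard (Set.range_subset_iff.2 hmem) hfin
  rw [← Set.image_univ, Set.ncard_image_of_injective _ hinj, Set.ncard_univ] at h
  simpa using h

lemma ncard_constOn_inter_le {n d : ℕ} (hn : 0 < n) (he : Even n) :
    (constOn n d 0 ∩ constOn n d 1).ncard ≤ 2 := by
  have hs : constOn n d 0 ∩ constOn n d 1 ⊆
      {fun v : Fin n => if (v : ℕ) % 2 = 0 then (0 : ℤ) else 1,
        fun v : Fin n => if (v : ℕ) % 2 = 0 then (0 : ℤ) else -1} := by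
    rintro f ⟨⟨hf, a, ha⟩, ⟨-, b, hb⟩⟩
    rw [mem_torusHom_iff hn] at hf
    have hlt : 1 < n := by obtain ⟨m, rfl⟩ := he; omega
    have ha0 : a = 0 := by
      rw [← ha ⟨0, hn⟩ ((mem_parityVertices_zero he _).2 rfl), hf.1]
    have hb1 : |b| = 1 := by
      have := hf.2 ⟨0, hn⟩ ⟨1, hlt⟩ (torusGraph_adj_of_val he (Nat.zero_le d) rfl)
      rwa [hf.1, hb _ ((mem_parityVertices_one he _).2 rfl), zero_sub, abs_neg] at this
    have hfv : ∀ v, f v = if (v : ℕ) % 2 = 0 then 0 else b := fun v => by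
      split_ifs with h
      · rw [ha v ((mem_parityVertices_zero he v).2 h), ha0]
      · exact hb v ((mem_parityVertices_one he v).2 (by omega))
    rcases eq_or_eq_neg_of_abs_eq hb1 with rfl | rfl
    · left; funext v; exact hfv v
    · right; funext v; exact hfv v
  exact (Set.ncard_le_ncard hs (by simp)).trans ((Set.ncard_insert_le _ _).trans (by simp))

/-! ### Probability bounds -/

lemma torusLaw_real {n d : ℕ} (hn : 0 < n) (he : Even n) {t : Set (Fin n → ℤ)}
    (ht : t ⊆ torusHom n d) :
    (torusLaw n d).real t = (t.ncard : ℝ) / (torusHom n d).ncard := by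
  have hfin := (ncard_torusHom_le_pathHom (d := d) hn he).1
  rw [torusLaw, uniformOn, measureReal_def, cond_apply hfin.measurableSet,
    Set.inter_eq_self_of_subset_right ht, Measure.count_apply_finite _ hfin,
    Measure.count_apply_finite _ (hfin.subset ht), Set.ncard_eq_toFinset_card _ hfin,
    Set.ncard_eq_toFinset_card _ (hfin.subset ht)]
  simp [div_eq_inv_mul]

lemma torusLaw_constOn_union_bounds {n d : ℕ} (hn : 0 < n) (he : Even n) :
    2 * (torusLaw n d).real (constOn n d 0) ≤
      (torusLaw n d).real (constOn n d 0 ∪ constOn n d 1) + 2 * (2 ^ (n / 2))⁻¹ ∧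
    (torusLaw n d).real (constOn n d 0 ∪ constOn n d 1) ≤ 1 := by
  have hfin := (ncard_torusHom_le_pathHom (d := d) hn he).1
  have hs : ∀ i, constOn n d i ⊆ torusHom n d := fun i f hf => hf.1
  have hu := Set.union_subset (hs 0) (hs 1)
  rw [torusLaw_real hn he (hs 0), torusLaw_real hn he hu]
  have hpow : 2 ^ (n / 2) ≤ (constOn n d 0).ncard := by
    obtain ⟨m, rfl⟩ := he
    rw [← two_mul] at *
    simpa using two_pow_le_ncard_constOn (d := d) (show 0 < m by omega)
  have h1 := Set.ncard_le_ncard (hs 0) hfin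
  have h2 := Set.ncard_le_ncard hu hfin
  have h3 := Set.ncard_union_add_ncard_inter (constOn n d 0) (constOn n d 1)
    (hfin.subset (hs 0)) (hfin.subset (hs 1))
  have h4 := ncard_constOn_inter_le (d := d) hn he
  have h5 := ncard_constOn_zero_eq_one (d := d) hn he
  have hN : (2 : ℝ) ^ (n / 2) ≤ (torusHom n d).ncard := by exact_mod_cast hpow.trans h1
  have hpos : (0 : ℝ) < 2 ^ (n / 2) := by positivity
  have hNpos := hpos.trans_le hN
  refine ⟨?_, ?_⟩
  · have : (2 : ℝ) / (torusHom n d).ncard ≤ 2 * (2 ^ (n / 2))⁻¹ := by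
      rw [div_eq_mul_inv]
      gcongr
    refine le_trans ?_ (add_le_add_right this _)
    rw [← mul_div_assoc, ← add_div]
    gcongr
    exact_mod_cast
      (by omega : 2 * (constOn n d 0).ncard ≤ (constOn n d 0 ∪ constOn n d 1).ncard + 2)
  · rw [div_le_one hNpos]
    exact_mod_cast h2

lemma exp_neg_le_torusLaw_constOn {n d : ℕ} (hn : 0 < n) (he : Even n) (hd : 1 ≤ d) :
    Real.exp (-(n * (2 ^ d)⁻¹)) ≤ 2 * (torusLaw n d).real (constOn n d 0) := by
  obtain ⟨m, rfl⟩ := he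
  rw [← two_mul] at *
  have he := even_two_mul m
  rw [torusLaw_real hn he fun f hf => hf.1]
  have hA : ((2 : ℝ) ^ m) ≤ (constOn (2 * m) d 0).ncard := by
    exact_mod_cast two_pow_le_ncard_constOn (d := d) (show 0 < m by omega)
  obtain ⟨hfin, hN⟩ := ncard_torusHom_le_pathHom (d := d) hn he
  have hN1 : ((torusHom (2 * m) d).ncard : ℝ) ≤ 2 * 2 ^ m * (1 + (2 ^ d)⁻¹) ^ m :=
    (Nat.cast_le.2 hN).trans (ncard_pathHom_even_le hd m)
  have hNpos : (0 : ℝ) < (torusHom (2 * m) d).ncard := by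
    have : ((constOn (2 * m) d 0).ncard : ℝ) ≤ (torusHom (2 * m) d).ncard := by
      exact_mod_cast Set.ncard_le_ncard
        (fun f (hf : f ∈ constOn (2 * m) d 0) => hf.1) hfin
    exact lt_of_lt_of_le (by positivity) (hA.trans this)
  have hexp : (1 + ((2 : ℝ) ^ d)⁻¹) ^ m ≤ Real.exp (((2 * m : ℕ) : ℝ) * (2 ^ d)⁻¹) := by
    calc (1 + ((2 : ℝ) ^ d)⁻¹) ^ m ≤ Real.exp ((2 ^ d)⁻¹) ^ m := by
          gcongr
          rw [add_comm]
          exact Real.add_one_le_exp _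
      _ = Real.exp (m * (2 ^ d)⁻¹) := (Real.exp_nat_mul _ _).symm
      -- A factor of two in the exponent is given away, to state the bound with `n = 2m`.
      _ ≤ _ := by
          gcongr
          omega
  rw [Real.exp_neg, ← mul_div_assoc, le_div_iff₀ hNpos, inv_mul_le_iff₀ (Real.exp_pos _)]
  calc _ ≤ _ := hN1
    _ = (1 + ((2 : ℝ) ^ d)⁻¹) ^ m * (2 * 2 ^ m) := by ring
    _ ≤ _ := by gcongr

/-! ### Limits -/

lemma eventually_evenAtTop : ∀ᶠ n in evenAtTop, 0 < n ∧ Even n :=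
  ((eventually_gt_atTop 0).filter_mono inf_le_left).and
    (mem_inf_of_right (mem_principal_self _))

lemma tendsto_mul_inv_two_pow {d : ℕ → ℕ}
    (h : Tendsto (fun n : ℕ => (d n : ℝ) - Real.logb 2 (n : ℝ)) evenAtTop atTop) :
    Tendsto (fun n : ℕ => (n : ℝ) * (2 ^ d n)⁻¹) evenAtTop (𝓝 0) := by
  have h1 : Tendsto (fun n : ℕ => ((2 : ℝ) ^ ((d n : ℝ) - Real.logb 2 n))⁻¹) evenAtTop (𝓝 0) :=
    tendsto_inv_atTop_zero.comp ((tendsto_rpow_atTop_of_base_gt_one 2 one_lt_two).comp h)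
  refine h1.congr' ?_
  filter_upwards [eventually_evenAtTop] with n hn
  have : (0 : ℝ) < n := by exact_mod_cast hn.1
  rw [Real.rpow_sub two_pos, Real.rpow_logb two_pos (by norm_num) this, Real.rpow_natCast, inv_div,
    div_eq_mul_inv]

lemma tendsto_inv_two_pow_half :
    Tendsto (fun n : ℕ => 2 * ((2 : ℝ) ^ (n / 2))⁻¹) evenAtTop (𝓝 0) := by
  have h1 : Tendsto (fun n : ℕ => n / 2) evenAtTop atTop :=
    (Nat.tendsto_div_const_atTop two_ne_zero).mono_left inf_le_left
  have h2 := (tendsto_inv_atTop_zero.comp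
    (tendsto_pow_atTop_atTop_of_one_lt (one_lt_two (α := ℝ)))).comp h1
  simpa using h2.const_mul 2

theorem corollary2p7 (d : ℕ → ℕ) (hd : ∀ n, 0 < n → Even n → 0 < d n)
    (hsuper : Tendsto (fun n : ℕ => (d n : ℝ) - Real.logb 2 (n : ℝ)) evenAtTop atTop) :
    (∀ n, 0 < n → Even n →
      (torusLaw n (d n)).real (constOn n (d n) 0 ∪ constOn n (d n) 1) =
        (torusLaw n (d n)).real (rangeLeThree n (d n))) ∧
    Tendsto (fun n => (torusLaw n (d n)).real (constOn n (d n) 0 ∪ constOn n (d n) 1))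
      evenAtTop (𝓝 1) ∧
    Tendsto (fun n => (torusLaw n (d n)).real (rangeLeThree n (d n))) evenAtTop (𝓝 1) ∧
    (∀ n, 0 < n → Even n →
      (torusLaw n (d n)).real (constOn n (d n) 0) =
        (torusLaw n (d n)).real (constOn n (d n) 1)) ∧
    Tendsto (fun n => (torusLaw n (d n)).real (constOn n (d n) 0)) evenAtTop (𝓝 (1 / 2)) ∧
    Tendsto (fun n => (torusLaw n (d n)).real (constOn n (d n) 1)) evenAtTop (𝓝 (1 / 2)) := by
  have hrange : ∀ n, 0 < n → Even n →
      (torusLaw n (d n)).real (constOn n (d n) 0 ∪ constOn n (d n) 1) =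
        (torusLaw n (d n)).real (rangeLeThree n (d n)) := fun n hn he => by
    rw [constOn_union_eq_rangeLeThree hn he]
  have hsymm : ∀ n, 0 < n → Even n →
      (torusLaw n (d n)).real (constOn n (d n) 0) =
        (torusLaw n (d n)).real (constOn n (d n) 1) := fun n hn he => by
    rw [torusLaw_real hn he fun f hf => hf.1, torusLaw_real hn he fun f hf => hf.1,
      ncard_constOn_zero_eq_one hn he]
  have hexp : Tendsto (fun n : ℕ => Real.exp (-(n * (2 ^ d n)⁻¹))) evenAtTop (𝓝 1) := by
    simpa [Function.comp_def] using
      (Real.continuous_exp.tendsto _).comp (tendsto_mul_inv_two_pow hsuper).neg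
  have htwo : Tendsto (fun n => 2 * (torusLaw n (d n)).real (constOn n (d n) 0))
      evenAtTop (𝓝 1) := by
    refine tendsto_of_tendsto_of_tendsto_of_le_of_le' hexp
      (by simpa using tendsto_inv_two_pow_half.const_add 1) ?_ ?_
    · filter_upwards [eventually_evenAtTop] with n ⟨hn, he⟩
      exact exp_neg_le_torusLaw_constOn hn he (hd n hn he)
    · filter_upwards [eventually_evenAtTop] with n ⟨hn, he⟩
      obtain ⟨h2, h3⟩ := torusLaw_constOn_union_bounds (d := d n) hn he
      linarith
  have hunion : Tendsto (fun n => (torusLaw n (d n)).real (constOn n (d n) 0 ∪ constOn n (d n) 1))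
      evenAtTop (𝓝 1) := by
    refine tendsto_of_tendsto_of_tendsto_of_le_of_le'
      (by simpa using htwo.sub tendsto_inv_two_pow_half) tendsto_const_nhds ?_ ?_
    · filter_upwards [eventually_evenAtTop] with n ⟨hn, he⟩
      obtain ⟨h2, -⟩ := torusLaw_constOn_union_bounds (d := d n) hn he
      linarith
    · filter_upwards [eventually_evenAtTop] with n ⟨hn, he⟩
      exact (torusLaw_constOn_union_bounds hn he).2
  have hzero : Tendsto (fun n => (torusLaw n (d n)).real (constOn n (d n) 0))
      evenAtTop (𝓝 (1 / 2)) := by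
    simpa only [mul_div_cancel_left₀ _ (two_ne_zero (α := ℝ))] using htwo.div_const 2
  refine ⟨hrange, hunion, hunion.congr' ?_, hsymm, hzero, hzero.congr' ?_⟩
  · filter_upwards [eventually_evenAtTop] with n ⟨hn, he⟩ using hrange n hn he
  · filter_upwards [eventually_evenAtTop] with n ⟨hn, he⟩ using hsymm n hn he
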